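/- Let $d\ge 0$, and let $h:\mathbb{R}^d\to\mathbb{R}$ be continuous, integrable and positive semi-definite (i.e. for all finite families $x_1,\dots,x_n\in\mathbb{R}^d$ the matrix $(h(x_i-x_j))_{i,j}$ is symmetric positive semi-definite), with $h(\tau)>0$ for all $\tau\in\mathbb{R}^d$ and $h(0)=1$. Let $K\ge 1$, and for $k=1,\dots,K$ let $\sigma_k>0$, $\gamma_k\in(0,\infty)^d$ and $\omega_k\in\mathbb{R}^d$. Consider the stationary generalized spectral kernel $$\kappa(\tau)=\sum_{k=1}^{K}\sigma_k^2\,h(\tau\odot\gamma_k)\cos(2\pi\,\omega_k^T\tau),\qquad \tau\in\mathbb{R}^d,$$ where $\odot$ is the elementwise product. Let $X=(X_t)_{t\in\mathbb{R}^d}$ and $Y=(Y_t)_{t\in\mathbb{R}^d}$ be real-valued mean-zero stationary Gaussian processes, on possibly different probability spaces, with $\operatorname{Cov}(X_s,X_t)=\kappa(s-t)$ and $\operatorname{Cov}(Y_s,Y_t)=h(s-t)$ for all $s,t\in\mathbb{R}^d$. Then for every integer $p\ge 0$, $X$ is $p$ times continuously differentiable in the mean-square sense if and only if $Y$ is. Here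 a process $(Z_t)_{t\in\mathbb{R}^d}$ of square-integrable random variables is called $p$ times continuously differentiable in the mean-square sense if all its iterated partial derivatives up to order $p$ exist as limits of difference quotients in $L^2$ at every point and, together with $Z$ itself, are continuous as functions of $t$ with values in $L^2$. -/

import Mathlib

open MeasureTheory ProbabilityTheory Filter Topology

noncomputable section

namespace SpectralKernel

/-- The elementwise product of two vectors of `ℝ^d`. -/
def hprod {d : ℕ} (x y : EuclideanSpace ℝ (Fin d)) : EuclideanSpace ℝ (Fin d) :=
  WithLp.toLp 2 (fun j => x j * y j)

/-- `h` is a real-valued stationary kernel: all matrices `(h (x i - x j))` are symmetric and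
positive semi-definite (`Matrix.PosSemidef` includes the symmetry). -/
def IsPSDFunction {d : ℕ} (h : EuclideanSpace ℝ (Fin d) → ℝ) : Prop :=
  ∀ (n : ℕ) (x : Fin n → EuclideanSpace ℝ (Fin d)),
    (Matrix.of fun i j : Fin n => h (x i - x j)).PosSemidef

/-- The function
`τ ↦ ∑ k, σ k ^ 2 * h (τ ⊙ γ k) * cos (2 π ⟨ω k, τ⟩)`. -/
def gsk {d K : ℕ} (h : EuclideanSpace ℝ (Fin d) → ℝ) (σ : Fin K → ℝ)
    (γ ω : Fin K → EuclideanSpace ℝ (Fin d)) (τ : EuclideanSpace ℝ (Fin d)) : ℝ :=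
  ∑ k, σ k ^ 2 * h (hprod τ (γ k)) * Real.cos (2 * Real.pi * inner ℝ (ω k) τ)

/-- `X` is a mean-zero stationary Gaussian process on `ℝ^d` with covariance function
`(s, t) ↦ c (s - t)`. (Since the mean is constant and the covariance depends only on `s - t`,
the Gaussian process is stationary, in the weak and hence in the strict sense.) -/
structure IsStationaryGP {d : ℕ} {Ω : Type*} [MeasurableSpace Ω]
    (X : EuclideanSpace ℝ (Fin d) → Ω → ℝ) (c : EuclideanSpace ℝ (Fin d) → ℝ)
    (P : Measure Ω) : Prop where
  gaussian : IsGaussianProcess X P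
  mean_zero : ∀ t, ∫ a, X t a ∂P = 0
  cov_eq : ∀ s t, covariance (X s) (X t) P = c (s - t)

/-- Mean-square continuity of a second-order process on `ℝ^d`. -/
def IsMSContinuous {d : ℕ} {Ω : Type*} [MeasurableSpace Ω] (P : Measure Ω)
    (X : EuclideanSpace ℝ (Fin d) → Ω → ℝ) : Prop :=
  (∀ t, MemLp (X t) 2 P) ∧
    ∀ t, Tendsto (fun s => eLpNorm (fun a => X s a - X t a) 2 P) (𝓝 t) (𝓝 0)

/-- The process `Z` is the mean-square partial derivative of `X` in the `j`-th coordinate: at each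
`t`, the difference quotients of `X` converge to `Z t` in `L²(P)`. -/
def IsMSPartialDeriv {d : ℕ} {Ω : Type*} [MeasurableSpace Ω] (P : Measure Ω) (j : Fin d)
    (X Z : EuclideanSpace ℝ (Fin d) → Ω → ℝ) : Prop :=
  ∀ t, Tendsto
    (fun ε : ℝ =>
      eLpNorm (fun a => (X (t + ε • EuclideanSpace.single j 1) a - X t a) / ε - Z t a) 2 P)
    (𝓝[≠] 0) (𝓝 0)

/-- `X` is `p` times continuously differentiable in the mean-square sense: all its iterated
mean-square partial derivatives up to order `p` exist and are mean-square continuous. -/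
def IsMSContDiff {d : ℕ} {Ω : Type*} [MeasurableSpace Ω] (P : Measure Ω) :
    ℕ → (EuclideanSpace ℝ (Fin d) → Ω → ℝ) → Prop
  | 0, X => IsMSContinuous P X
  | p + 1, X => IsMSContinuous P X ∧
      ∀ j : Fin d, ∃ Z : EuclideanSpace ℝ (Fin d) → Ω → ℝ,
        IsMSPartialDeriv P j X Z ∧ IsMSContDiff P p Z

end SpectralKernel

end

open scoped InnerProductSpace

namespace SpectralKernel

variable {d : ℕ} {H H' : Type*} [NormedAddCommGroup H] [InnerProductSpace ℝ H]
  [NormedAddCommGroup H'] [InnerProductSpace ℝ H']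

/-! Mean-square smoothness of a process is smoothness of the curve `t ↦ X t` in `L²`. It depends
only on the Gram kernel: curves in Hilbert spaces with equal Gram kernels are carried to each other
by bounded linear maps (`exists_clm_of_inner_eq`), which preserve continuous partials. So `X` may be
replaced by any curve with kernel `κ`. Let `v` be the curve of `Y`. By `cos (a - b) = cos a cos b +
sin a sin b`, the curve with components `σ k cos(2π⟨ω k, t⟩) v(t ⊙ γ k)` and `σ k sin(2π⟨ω k, t⟩)
v(t ⊙ γ k)` has kernel `κ`. It is as smooth as `v`. Conversely, `cos² + sin² = 1` recovers `v(t ⊙ γ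
k)` from the two components of a single `k`, and rescaling the coordinates recovers `v`. -/

/-- All iterated partial derivatives up to order `p` of the map `u : ℝ^d → H` exist and are
continuous. -/
def HasContPartials : ℕ → (EuclideanSpace ℝ (Fin d) → H) → Prop
  | 0, u => Continuous u
  | p + 1, u => Continuous u ∧ ∀ j : Fin d, ∃ z : EuclideanSpace ℝ (Fin d) → H,
      (∀ t, HasLineDerivAt ℝ u (z t) t (EuclideanSpace.single j 1)) ∧ HasContPartials p z

namespace HasContPartials

theorem of_succ {p : ℕ} {u : EuclideanSpace ℝ (Fin d) → H} (hu : HasContPartials (p + 1) u) :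
    HasContPartials p u := by
  induction p generalizing u with
  | zero => exact hu.1
  | succ p ih =>
    refine ⟨hu.1, fun j => ?_⟩
    obtain ⟨z, hz, hzp⟩ := hu.2 j
    exact ⟨z, hz, ih hzp⟩

theorem clm_comp {p : ℕ} {u : EuclideanSpace ℝ (Fin d) → H} (hu : HasContPartials p u)
    (T : H →L[ℝ] H') : HasContPartials p (fun t => T (u t)) := by
  induction p generalizing u with
  | zero => exact T.continuous.comp hu
  | succ p ih =>
    refine ⟨T.continuous.comp hu.1, fun j => ?_⟩
    obtain ⟨z, hz, hzp⟩ := hu.2 j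
    exact ⟨fun t => T (z t), fun t => T.hasFDerivAt.comp_hasDerivAt 0 (hz t), ih hzp⟩

theorem const_smul {p : ℕ} {u : EuclideanSpace ℝ (Fin d) → H} (hu : HasContPartials p u)
    (a : ℝ) : HasContPartials p (fun t => a • u t) :=
  hu.clm_comp (a • ContinuousLinearMap.id ℝ H)

theorem zero (p : ℕ) : HasContPartials p (fun _ : EuclideanSpace ℝ (Fin d) => (0 : H)) := by
  induction p with
  | zero => exact continuous_const
  | succ p ih => exact ⟨continuous_const, fun j => ⟨_, fun t => hasDerivAt_const _ _, ih⟩⟩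

theorem add {p : ℕ} {u v : EuclideanSpace ℝ (Fin d) → H} (hu : HasContPartials p u)
    (hv : HasContPartials p v) : HasContPartials p (fun t => u t + v t) := by
  induction p generalizing u v with
  | zero => exact Continuous.add hu hv
  | succ p ih =>
    refine ⟨hu.1.add hv.1, fun j => ?_⟩
    obtain ⟨y, hy, hyp⟩ := hu.2 j
    obtain ⟨z, hz, hzp⟩ := hv.2 j
    exact ⟨fun t => y t + z t, fun t => HasDerivAt.add (hy t) (hz t), ih hyp hzp⟩

theorem sum {p : ℕ} {ι : Type*} (s : Finset ι) {u : ι → EuclideanSpace ℝ (Fin d) → H}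
    (hu : ∀ i, HasContPartials p (u i)) : HasContPartials p (fun t => ∑ i ∈ s, u i t) := by
  classical
  induction s using Finset.induction_on with
  | empty => simpa using zero p
  | insert i s hi ih => simpa [Finset.sum_insert hi] using (hu i).add ih

theorem piLp {p : ℕ} {ι : Type*} [Fintype ι] {u : ι → EuclideanSpace ℝ (Fin d) → H}
    (hu : ∀ i, HasContPartials p (u i)) :
    HasContPartials p (fun t => (WithLp.toLp 2 (fun i => u i t) : PiLp 2 (fun _ : ι => H))) := by
  classical
  let S : (i : ι) → H →L[ℝ] PiLp 2 (fun _ : ι => H) := fun i =>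
    ((PiLp.continuousLinearEquiv 2 ℝ (fun _ : ι => H)).symm.toContinuousLinearMap).comp
      (ContinuousLinearMap.single ℝ (fun _ : ι => H) i)
  have key := sum Finset.univ fun i => (hu i).clm_comp (S i)
  convert key using 2 with t
  ext i
  simp [S, Finset.sum_apply, Pi.single_apply]

/-- Multiplication by the cosine wave `t ↦ cos (2 π ⟨ω, t⟩ + c)` preserves `HasContPartials`. -/
theorem cos_smul {p : ℕ} {u : EuclideanSpace ℝ (Fin d) → H} (hu : HasContPartials p u)
    (ω : EuclideanSpace ℝ (Fin d)) (c : ℝ) :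
    HasContPartials p (fun t => Real.cos (2 * Real.pi * ⟪ω, t⟫_ℝ + c) • u t) := by
  have hc : ∀ c, Continuous fun t : EuclideanSpace ℝ (Fin d) =>
      Real.cos (2 * Real.pi * ⟪ω, t⟫_ℝ + c) := fun c => by fun_prop
  induction p generalizing u c with
  | zero => exact (hc c).smul hu
  | succ p ih =>
    refine ⟨(hc c).smul hu.1, fun j => ?_⟩
    obtain ⟨z, hz, hzp⟩ := hu.2 j
    -- Differentiating the cosine shifts its phase by `π / 2`; a free phase `c` is what lets the
    -- induction close.
    refine ⟨_, fun t => ?_,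
      (ih hzp c).add ((ih hu.of_succ (c + Real.pi / 2)).const_smul (2 * Real.pi * ω j))⟩
    have h1 : HasDerivAt (fun ε : ℝ =>
        2 * Real.pi * ⟪ω, t + ε • EuclideanSpace.single j (1 : ℝ)⟫_ℝ + c)
        (2 * Real.pi * ω j) 0 := by
      have : ∀ ε : ℝ, 2 * Real.pi * ⟪ω, t + ε • EuclideanSpace.single j (1 : ℝ)⟫_ℝ + c =
          (2 * Real.pi * ω j) * ε + (2 * Real.pi * ⟪ω, t⟫_ℝ + c) := by
        intro ε
        simp only [inner_add_right, inner_smul_right, EuclideanSpace.inner_single_right,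
          conj_trivial]
        ring
      simp only [this]
      simpa using ((hasDerivAt_id (0 : ℝ)).const_mul (2 * Real.pi * ω j)).add_const
        (2 * Real.pi * ⟪ω, t⟫_ℝ + c)
    have h2 := h1.cos.smul (hz t)
    simp only [zero_smul, add_zero] at h2
    refine HasDerivAt.congr_deriv h2 ?_
    rw [← add_assoc, Real.cos_add_pi_div_two, smul_smul]
    congr 2
    ring

theorem comp_hprod {p : ℕ} {u : EuclideanSpace ℝ (Fin d) → H} (hu : HasContPartials p u)
    (γ : EuclideanSpace ℝ (Fin d)) : HasContPartials p (fun t => u (hprod t γ)) := by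
  have hc : Continuous fun t : EuclideanSpace ℝ (Fin d) => hprod t γ := by
    unfold hprod
    fun_prop
  induction p generalizing u with
  | zero => exact Continuous.comp hu hc
  | succ p ih =>
    refine ⟨hu.1.comp hc, fun j => ?_⟩
    obtain ⟨z, hz, hzp⟩ := hu.2 j
    refine ⟨_, fun t => ?_, (ih hzp).const_smul (γ j)⟩
    have h1 : HasDerivAt (fun ε : ℝ => ε * γ j) (γ j) 0 := by
      simpa using (hasDerivAt_id (0 : ℝ)).mul_const (γ j)
    -- A step `ε` along the `j`-th axis becomes a step `ε * γ j` along the same axis.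
    have h2 := HasDerivAt.scomp_of_eq (0 : ℝ) (hz (hprod t γ)) h1 (by simp)
    unfold HasLineDerivAt
    convert h2 using 1
    ext1 ε
    simp only [Function.comp]
    congr 1
    ext i
    by_cases hij : i = j
    · subst hij
      simp [hprod]
      ring
    · simp [hprod, hij]

end HasContPartials

/-- Two families in Hilbert spaces with the same Gram kernel are related by a continuous linear
map. -/
theorem exists_clm_of_inner_eq {ι : Type*} [CompleteSpace H] [CompleteSpace H']
    (u : ι → H) (v : ι → H') (huv : ∀ s t, ⟪u s, u t⟫_ℝ = ⟪v s, v t⟫_ℝ) :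
    ∃ T : H →L[ℝ] H', ∀ t, T (u t) = v t := by
  let U := Finsupp.linearCombination ℝ u
  let V := Finsupp.linearCombination ℝ v
  -- Hence `U a ↦ V a` is a well-defined isometry on the span of `u`.
  have hnorm : ∀ a, ‖V a‖ = ‖U a‖ := by
    intro a
    have : ⟪V a, V a⟫_ℝ = ⟪U a, U a⟫_ℝ := by
      simp only [U, V, Finsupp.linearCombination_apply, Finsupp.sum, sum_inner, inner_sum,
        inner_smul_left, inner_smul_right, huv]
    rw [real_inner_self_eq_norm_sq, real_inner_self_eq_norm_sq] at this
    exact (pow_left_inj₀ (norm_nonneg _) (norm_nonneg _) two_ne_zero).1 this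
  let S := (LinearMap.range U).topologicalClosure
  have hUS : ∀ a, U a ∈ S := fun a => Submodule.le_topologicalClosure _ ⟨a, rfl⟩
  let e : (ι →₀ ℝ) →ₗ[ℝ] S := U.codRestrict S hUS
  have hdense : DenseRange e := by
    intro x
    rw [Metric.mem_closure_iff]
    intro ε hε
    obtain ⟨y, ⟨a, rfl⟩, hy⟩ := Metric.mem_closure_iff.1
      (show (x : H) ∈ closure (LinearMap.range U : Set H) from x.2) ε hε
    exact ⟨e a, ⟨a, rfl⟩, hy⟩
  have : CompleteSpace S :=
    (Submodule.isClosed_topologicalClosure (LinearMap.range U)).completeSpace_coe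
  -- Extend by density to the closed span; the orthogonal projection makes the map defined on all of
  -- `H`.
  refine ⟨(V.extendOfNorm e).comp S.orthogonalProjectionOnto, fun t => ?_⟩
  have hu : u t = (e (Finsupp.single t 1) : S) := by simp [e, U]
  rw [ContinuousLinearMap.comp_apply, hu, Submodule.orthogonalProjectionOnto_mem_subspace_eq_self,
    LinearMap.extendOfNorm_eq hdense ⟨1, fun a => by rw [one_mul, hnorm]; rfl⟩]
  simp [V]

section MeanSquare

variable {Ω : Type*} [MeasurableSpace Ω] {P : Measure Ω}

theorem IsMSContDiff.memLp {p : ℕ} {X : EuclideanSpace ℝ (Fin d) → Ω → ℝ}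
    (hX : IsMSContDiff P p X) (t : EuclideanSpace ℝ (Fin d)) : MemLp (X t) 2 P := by
  cases p with
  | zero => exact hX.1 t
  | succ p => exact hX.1.1 t

theorem isMSContinuous_iff_continuous_toLp {X : EuclideanSpace ℝ (Fin d) → Ω → ℝ}
    (hX : ∀ t, MemLp (X t) 2 P) :
    IsMSContinuous P X ↔ Continuous fun t => (hX t).toLp (X t) := by
  rw [IsMSContinuous, and_iff_right hX, continuous_iff_continuousAt]
  exact forall_congr' fun t =>
    (Lp.tendsto_Lp_iff_tendsto_eLpNorm'' X hX (X t) (hX t)).symm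

theorem isMSPartialDeriv_iff_hasLineDerivAt_toLp {X Z : EuclideanSpace ℝ (Fin d) → Ω → ℝ}
    (hX : ∀ t, MemLp (X t) 2 P) (hZ : ∀ t, MemLp (Z t) 2 P) (j : Fin d) :
    IsMSPartialDeriv P j X Z ↔ ∀ t, HasLineDerivAt ℝ (fun t => (hX t).toLp (X t))
      ((hZ t).toLp (Z t)) t (EuclideanSpace.single j 1) := by
  refine forall_congr' fun t => ?_
  rw [hasLineDerivAt_iff_tendsto_slope_zero]
  have key := Lp.tendsto_Lp_iff_tendsto_eLpNorm'' (fi := 𝓝[≠] (0 : ℝ))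
    (fun ε => ε⁻¹ • (X (t + ε • EuclideanSpace.single j 1) - X t))
    (fun ε => ((hX _).sub (hX t)).const_smul ε⁻¹) (Z t) (hZ t)
  refine Iff.trans (Iff.of_eq ?_) key.symm
  congr! 4 with ε a
  simp [div_eq_inv_mul]

theorem isMSContDiff_iff_hasContPartials_toLp (p : ℕ) {X : EuclideanSpace ℝ (Fin d) → Ω → ℝ}
    (hX : ∀ t, MemLp (X t) 2 P) :
    IsMSContDiff P p X ↔ HasContPartials p fun t => (hX t).toLp (X t) := by
  induction p generalizing X with
  | zero => exact isMSContinuous_iff_continuous_toLp hX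
  | succ p ih =>
    refine and_congr (isMSContinuous_iff_continuous_toLp hX) (forall_congr' fun j => ⟨?_, ?_⟩)
    · rintro ⟨Z, hZ, hZp⟩
      exact ⟨_, (isMSPartialDeriv_iff_hasLineDerivAt_toLp hX hZp.memLp j).1 hZ,
        (ih hZp.memLp).1 hZp⟩
    · rintro ⟨z, hz, hzp⟩
      -- The derivative curve consists of `L²` classes; chosen representatives form the required
      -- process.
      have hmem : ∀ t, MemLp (z t) 2 P := fun t => Lp.memLp (z t)
      have heq : (fun t => (hmem t).toLp (z t)) = z := funext fun t => Lp.toLp_coeFn (z t) _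
      refine ⟨fun t => z t, (isMSPartialDeriv_iff_hasLineDerivAt_toLp hX hmem j).2 fun t => ?_,
        (ih hmem).2 ?_⟩
      · rw [Lp.toLp_coeFn]
        exact hz t
      · rwa [heq]

theorem IsStationaryGP.memLp_two {X : EuclideanSpace ℝ (Fin d) → Ω → ℝ}
    {c : EuclideanSpace ℝ (Fin d) → ℝ} (hX : IsStationaryGP X c P)
    (t : EuclideanSpace ℝ (Fin d)) : MemLp (X t) 2 P :=
  (hX.gaussian.hasGaussianLaw_eval t).memLp_two

theorem IsStationaryGP.inner_toLp [IsProbabilityMeasure P] {X : EuclideanSpace ℝ (Fin d) → Ω → ℝ}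
    {c : EuclideanSpace ℝ (Fin d) → ℝ} (hX : IsStationaryGP X c P)
    (s t : EuclideanSpace ℝ (Fin d)) :
    ⟪(hX.memLp_two s).toLp (X s), (hX.memLp_two t).toLp (X t)⟫_ℝ = c (s - t) := by
  rw [← hX.cov_eq, covariance_eq_sub (hX.memLp_two s) (hX.memLp_two t), hX.mean_zero, zero_mul,
    sub_zero, L2.inner_def]
  refine integral_congr_ae ?_
  filter_upwards [(hX.memLp_two s).coeFn_toLp, (hX.memLp_two t).coeFn_toLp] with a h1 h2
  simp [h1, h2, mul_comm]

end MeanSquare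

/-- A family with Gram kernel `gsk h σ γ ω`, built from a family `v` with Gram kernel `h`. -/
noncomputable def spectralFamily {K : ℕ} (σ : Fin K → ℝ) (γ ω : Fin K → EuclideanSpace ℝ (Fin d))
    (v : EuclideanSpace ℝ (Fin d) → H) (t : EuclideanSpace ℝ (Fin d)) :
    PiLp 2 (fun _ : Fin K × Fin 2 => H) :=
  WithLp.toLp 2 fun i => σ i.1 •
    -- The phase `-(π / 2)` yields the sine, so `cos_smul` covers both components.
    (Real.cos (2 * Real.pi * ⟪ω i.1, t⟫_ℝ + ![0, -(Real.pi / 2)] i.2) • v (hprod t (γ i.1)))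

theorem hprod_sub (s t γ : EuclideanSpace ℝ (Fin d)) :
    hprod s γ - hprod t γ = hprod (s - t) γ := by
  ext i
  simp [hprod, sub_mul]

theorem inner_spectralFamily {K : ℕ} (σ : Fin K → ℝ) (γ ω : Fin K → EuclideanSpace ℝ (Fin d))
    {h : EuclideanSpace ℝ (Fin d) → ℝ} {v : EuclideanSpace ℝ (Fin d) → H}
    (hv : ∀ s t, ⟪v s, v t⟫_ℝ = h (s - t)) (s t : EuclideanSpace ℝ (Fin d)) :
    ⟪spectralFamily σ γ ω v s, spectralFamily σ γ ω v t⟫_ℝ = gsk h σ γ ω (s - t) := by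
  rw [PiLp.inner_apply, Fintype.sum_prod_type, gsk]
  refine Finset.sum_congr rfl fun k _ => ?_
  simp only [spectralFamily, inner_smul_left, inner_smul_right, hv, hprod_sub, Fin.sum_univ_two,
    Matrix.cons_val_zero, Matrix.cons_val_one, add_zero, conj_trivial, ← sub_eq_add_neg,
    Real.cos_sub_pi_div_two]
  rw [inner_sub_right, mul_sub, Real.cos_sub]
  ring

theorem hasContPartials_spectralFamily_iff {K : ℕ} (hK : 0 < K) {σ : Fin K → ℝ}
    (hσ : ∀ k, 0 < σ k) {γ : Fin K → EuclideanSpace ℝ (Fin d)} (hγ : ∀ k j, 0 < γ k j)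
    (ω : Fin K → EuclideanSpace ℝ (Fin d)) (v : EuclideanSpace ℝ (Fin d) → H) (p : ℕ) :
    HasContPartials p (spectralFamily σ γ ω v) ↔ HasContPartials p v := by
  refine ⟨fun hw => ?_, fun hv => .piLp fun i =>
    ((hv.comp_hprod (γ i.1)).cos_smul (ω i.1) _).const_smul (σ i.1)⟩
  let k : Fin K := ⟨0, hK⟩
  -- Multiply each component again by its own wave, so that the sum over `b` produces `cos² + sin²`.
  have hcoord : ∀ b : Fin 2, HasContPartials p fun t =>
      Real.cos (2 * Real.pi * ⟪ω k, t⟫_ℝ + ![0, -(Real.pi / 2)] b) •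
        spectralFamily σ γ ω v t (k, b) := fun b =>
    (hw.clm_comp (PiLp.proj 2 (fun _ : Fin K × Fin 2 => H) (k, b))).cos_smul (ω k) _
  have hscaled : HasContPartials p fun t => v (hprod t (γ k)) := by
    convert ((hcoord 0).add (hcoord 1)).const_smul (σ k)⁻¹ using 2 with t
    simp only [spectralFamily, Matrix.cons_val_zero, Matrix.cons_val_one, add_zero,
      ← sub_eq_add_neg, Real.cos_sub_pi_div_two, smul_smul, ← add_smul]
    have hσk := (hσ k).ne'
    have := Real.sin_sq_add_cos_sq (2 * Real.pi * ⟪ω k, t⟫_ℝ)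
    rw [show (σ k)⁻¹ * (Real.cos (2 * Real.pi * ⟪ω k, t⟫_ℝ) *
        (σ k * Real.cos (2 * Real.pi * ⟪ω k, t⟫_ℝ)) + Real.sin (2 * Real.pi * ⟪ω k, t⟫_ℝ) *
        (σ k * Real.sin (2 * Real.pi * ⟪ω k, t⟫_ℝ))) = 1 by
      field_simp
      linarith, one_smul]
  convert hscaled.comp_hprod (WithLp.toLp 2 fun j => (γ k j)⁻¹) using 2 with t
  congr 1
  ext j
  simp [hprod, (hγ k j).ne']

end SpectralKernel

theorem proposition1 {d K : ℕ} (hK : 0 < K)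
    (h : EuclideanSpace ℝ (Fin d) → ℝ)
    (h_psd : SpectralKernel.IsPSDFunction h) (h_cont : Continuous h)
    (h_int : Integrable h volume) (h_pos : ∀ τ, 0 < h τ) (h_zero : h 0 = 1)
    (σ : Fin K → ℝ) (hσ : ∀ k, 0 < σ k)
    (γ ω : Fin K → EuclideanSpace ℝ (Fin d)) (hγ : ∀ k j, 0 < γ k j)
    {Ω : Type*} [MeasurableSpace Ω] (P : Measure Ω) [IsProbabilityMeasure P]
    (X : EuclideanSpace ℝ (Fin d) → Ω → ℝ)
    (hX : SpectralKernel.IsStationaryGP X (SpectralKernel.gsk h σ γ ω) P)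
    {Ω' : Type*} [MeasurableSpace Ω'] (P' : Measure Ω') [IsProbabilityMeasure P']
    (Y : EuclideanSpace ℝ (Fin d) → Ω' → ℝ)
    (hY : SpectralKernel.IsStationaryGP Y h P')
    (p : ℕ) :
    SpectralKernel.IsMSContDiff P p X ↔ SpectralKernel.IsMSContDiff P' p Y := by
  rw [SpectralKernel.isMSContDiff_iff_hasContPartials_toLp p hX.memLp_two,
    SpectralKernel.isMSContDiff_iff_hasContPartials_toLp p hY.memLp_two,
    ← SpectralKernel.hasContPartials_spectralFamily_iff hK hσ hγ ω
      (fun t => (hY.memLp_two t).toLp (Y t))]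
  have hgram := fun s t => (hX.inner_toLp s t).trans
    (SpectralKernel.inner_spectralFamily σ γ ω hY.inner_toLp s t).symm
  obtain ⟨T, hT⟩ := SpectralKernel.exists_clm_of_inner_eq _ _ hgram
  obtain ⟨T', hT'⟩ := SpectralKernel.exists_clm_of_inner_eq _ _ fun s t => (hgram s t).symm
  exact ⟨fun hu => by simpa only [hT] using hu.clm_comp T,
    fun hw => by simpa only [hT'] using hw.clm_comp T'⟩
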